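/- Let $M$ be a second countable Hausdorff smooth manifold of dimension $n$ and $\nabla$ a smooth covariant derivative on $M$ (torsion is allowed). For a chart $(U,\varphi)$ of $M$ let $\Gamma\colon \varphi(U) \to \mathrm{L}^2(\mathbb{R}^n\times\mathbb{R}^n,\mathbb{R}^n)$ be the Christoffel symbol of $\nabla$, so that locally $\nabla_X Y = Y'\cdot X + \Gamma(X,Y)$; geodesics satisfy $\ddot u = -\Gamma(u)(\dot u,\dot u)$, and parallel vector fields $\rho$ along a curve $\sigma$ satisfy $\dot\rho = -\Gamma(\sigma)(\dot\sigma,\rho)$. A transport operator on $M$ is a smooth section $A$ of the bundle over $M\times M$ whose fibre at $(p,q)$ is the space $\mathrm{L}(\mathrm{T}_pM,\mathrm{T}_qM)$ of linear maps. It is said to be associated to $\nabla$ if each point of $M$ has an open neighbourhood $W$ such that any two points $p,q\in W$ are joined by a unique geodesic $[0,1]\to M$ contained in $W$, and $A(p,q)$ is the parallel transport from $p$ to $q$ along this geodesic. Its local representation in the chart is $$a(x,y) = \mathrm{T}_{\varphi^{-1}(y)}\varphi\circ A(\varphi^{-1}(x),\varphi^{-1}(y))\circ(\mathrm{T}_{\varphi^{-1}(x)}\varphi)^{-1}.$$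 Lemma. Let $A$ be a transport operator associated to $\nabla$ and let $(U,\varphi)$ be an arbitrary chart on $M$. Then $\Gamma$ is smooth on $\varphi(U)$, $a\in C^\infty(\varphi(U)\times\varphi(U),\mathrm{L}(\mathbb{R}^n,\mathbb{R}^n))$, and for all $x\in\varphi(U)$ and $\xi,\eta,\xi_1,\eta_1,\xi_2,\eta_2,\zeta\in\mathbb{R}^n$: (i) $a(x,x)=\mathrm{id}$; (ii) $a'(x,x)(\xi,\eta)\cdot\zeta = -\Gamma(x)(\eta-\xi,\zeta)$; (iii) $2\,a''(x,x)((\xi_1,\eta_1),(\xi_2,\eta_2))\cdot\zeta = -(\Gamma'(x)\cdot(\eta_1+\xi_1))(\eta_2-\xi_2,\zeta) - (\Gamma'(x)\cdot(\eta_2+\xi_2))(\eta_1-\xi_1,\zeta) + \Gamma(x)(\eta_1-\xi_1,\Gamma(x)(\eta_2-\xi_2,\zeta)) + \Gamma(x)(\eta_2-\xi_2,\Gamma(x)(\eta_1-\xi_1,\zeta)).$ Here $'$ denotes the differential with respect to all space variables. -/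

import Mathlib

open Set Filter
open scoped Manifold ContDiff Topology

noncomputable section

namespace TransportOp

variable {n : ℕ} {M : Type*} [TopologicalSpace M] [ChartedSpace (EuclideanSpace ℝ (Fin n)) M]

/-- The differential at `p` of a chart `e` of `M`, as a map from `T_p M` to `ℝⁿ`. -/
def chartDeriv (e : OpenPartialHomeomorph M (EuclideanSpace ℝ (Fin n))) (p : M) :
    TangentSpace (𝓡 n) p →L[ℝ] EuclideanSpace ℝ (Fin n) :=
  mfderiv (𝓡 n) (𝓡 n) e p

/-- The coordinate vector field on the domain of the chart `e` that is represented in `e` by the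
constant vector `w`. (The values off the domain of `e` are irrelevant.) -/
def coordField (e : OpenPartialHomeomorph M (EuclideanSpace ℝ (Fin n)))
    (w : EuclideanSpace ℝ (Fin n)) (p : M) : TangentSpace (𝓡 n) p :=
  (chartDeriv e p).inverse w

/-- The local representation `(x, y) ↦ Te' ∘ A(e⁻¹ x, e'⁻¹ y) ∘ (Te)⁻¹` of a family of linear maps
`A(p, q) : T_p M → T_q M` with respect to charts `e` and `e'`. -/
def localRep (A : ∀ p q : M, TangentSpace (𝓡 n) p →L[ℝ] TangentSpace (𝓡 n) q)
    (e e' : OpenPartialHomeomorph M (EuclideanSpace ℝ (Fin n)))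
    (z : EuclideanSpace ℝ (Fin n) × EuclideanSpace ℝ (Fin n)) :
    EuclideanSpace ℝ (Fin n) →L[ℝ] EuclideanSpace ℝ (Fin n) :=
  (chartDeriv e' (e'.symm z.2)).comp
    ((A (e.symm z.1) (e'.symm z.2)).comp (chartDeriv e (e.symm z.1)).inverse)

variable [IsManifold (𝓡 n) ∞ M]

/-- The Christoffel symbol `Γ : e.target → L²(ℝⁿ × ℝⁿ, ℝⁿ)` of `∇` in the chart `e`:
`Γ(x)(v, w) = ∑ j, wⱼ (∇_v ∂ⱼ)(x)`, read in the chart. The first slot is the direction of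
differentiation, so that `∇_X Y = Y' · X + Γ(X, Y)` in the chart. -/
def christoffel (cov : CovariantDerivative (𝓡 n) (EuclideanSpace ℝ (Fin n))
      (TangentSpace (𝓡 n) : M → Type _))
    (e : OpenPartialHomeomorph M (EuclideanSpace ℝ (Fin n))) (x : EuclideanSpace ℝ (Fin n)) :
    EuclideanSpace ℝ (Fin n) →L[ℝ] EuclideanSpace ℝ (Fin n) →L[ℝ] EuclideanSpace ℝ (Fin n) :=
  ∑ j : Fin n,
    (ContinuousLinearMap.smulRightL ℝ (EuclideanSpace ℝ (Fin n)) (EuclideanSpace ℝ (Fin n))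
        (EuclideanSpace.proj j)).comp
      ((chartDeriv e (e.symm x)).comp
        ((cov (coordField e (EuclideanSpace.single j 1)) (e.symm x)).comp
          (chartDeriv e (e.symm x)).inverse))

/-- `V` is a parallel vector field along the curve `c` on `s`: in every chart,
`V̇ = -Γ(c)(ċ, V)`. -/
def IsParallelAlong (cov : CovariantDerivative (𝓡 n) (EuclideanSpace ℝ (Fin n))
      (TangentSpace (𝓡 n) : M → Type _))
    (c : ℝ → M) (V : ∀ t : ℝ, TangentSpace (𝓡 n) (c t)) (s : Set ℝ) : Prop :=
  ∀ e ∈ IsManifold.maximalAtlas (𝓡 n) ∞ M, ∀ t ∈ s, c t ∈ e.source →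
    HasDerivWithinAt (fun τ : ℝ => chartDeriv e (c τ) (V τ))
      (-(christoffel cov e (e (c t)) (derivWithin (fun τ : ℝ => e (c τ)) s t)
        (chartDeriv e (c t) (V t)))) s t

/-- The velocity field of a curve in `M`. -/
def velocity (c : ℝ → M) (s : Set ℝ) (t : ℝ) : TangentSpace (𝓡 n) (c t) :=
  mfderivWithin 𝓘(ℝ, ℝ) (𝓡 n) c s t (1 : ℝ)

/-- A geodesic of `∇`: a smooth curve whose velocity field is parallel along it, that is,
`ü = -Γ(u)(u̇, u̇)` in every chart. -/
def IsGeodesicOn (cov : CovariantDerivative (𝓡 n) (EuclideanSpace ℝ (Fin n))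
      (TangentSpace (𝓡 n) : M → Type _)) (c : ℝ → M) (s : Set ℝ) : Prop :=
  ContMDiffOn 𝓘(ℝ, ℝ) (𝓡 n) ∞ c s ∧ IsParallelAlong cov c (velocity c s) s

/-- Any two points of `U` are joined by a unique geodesic `[0, 1] → M` contained in `U`. -/
def IsGeodesicallyConvex (cov : CovariantDerivative (𝓡 n) (EuclideanSpace ℝ (Fin n))
      (TangentSpace (𝓡 n) : M → Type _)) (U : Set M) : Prop :=
  ∀ q ∈ U, ∀ r ∈ U,
    (∃ c : ℝ → M, IsGeodesicOn cov c (Icc 0 1) ∧ MapsTo c (Icc 0 1) U ∧ c 0 = q ∧ c 1 = r) ∧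
    ∀ c₁ c₂ : ℝ → M,
      (IsGeodesicOn cov c₁ (Icc 0 1) ∧ MapsTo c₁ (Icc 0 1) U ∧ c₁ 0 = q ∧ c₁ 1 = r) →
      (IsGeodesicOn cov c₂ (Icc 0 1) ∧ MapsTo c₂ (Icc 0 1) U ∧ c₂ 0 = q ∧ c₂ 1 = r) →
      EqOn c₁ c₂ (Icc 0 1)

variable (n M) in
/-- A transport operator on `M`: a smooth section of the bundle over `M × M` whose fibre over
`(p, q)` is `L(T_p M, T_q M)`. Smoothness means that in all charts it is given by a smoothly
parametrized matrix. -/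
structure TransportOperator where
  toFun : ∀ p q : M, TangentSpace (𝓡 n) p →L[ℝ] TangentSpace (𝓡 n) q
  smooth : ∀ e ∈ IsManifold.maximalAtlas (𝓡 n) ∞ M, ∀ e' ∈ IsManifold.maximalAtlas (𝓡 n) ∞ M,
    ContDiffOn ℝ ∞ (localRep toFun e e') (e.target ×ˢ e'.target)

/-- The transport operator `A` is associated to `∇`: every point has an open geodesically convex
neighbourhood `U` on which `A` is parallel transport along the geodesics in `U`. -/
def TransportOperator.IsAssociated (A : TransportOperator n M)
    (cov : CovariantDerivative (𝓡 n) (EuclideanSpace ℝ (Fin n))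
      (TangentSpace (𝓡 n) : M → Type _)) : Prop :=
  ∀ p : M, ∃ U : Set M, IsOpen U ∧ p ∈ U ∧ IsGeodesicallyConvex cov U ∧
    ∀ c : ℝ → M, IsGeodesicOn cov c (Icc 0 1) → MapsTo c (Icc 0 1) U →
      ∀ V : (∀ t : ℝ, TangentSpace (𝓡 n) (c t)), IsParallelAlong cov c V (Icc 0 1) →
        A.toFun (c 0) (c 1) (V 0) = V 1

end TransportOp

end

/-! Fix `x` in the chart, a velocity `v` and a vector `ζ`. Picard–Lindelöf gives in the chart a
short geodesic `u` from `x` with velocity `w`, `w 0 = v`, and a parallel field `W` along it with `W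
0 = ζ`. For small `s` of either sign, `t ↦ u (s * t)` on `[0, 1]` is a geodesic inside the
neighbourhood on which `A` is parallel transport. Hence `a (x, u s) ζ = W s`
(`exists_geodesic_localRep`), and everything is read off from this identity.

At `s = 0` it is (i). Its first derivative is `a'(0, w) ζ = -Γ(w, W)`; together with the derivative
of (i) along the diagonal this gives (ii). The second derivative at `0` gives `a''` on `(0, v), (0,
v)`, the derivative of (ii) along the diagonal gives `a''` on `(v, v), (ξ, η)`, and symmetry of
`a''` with polarization yields (iii) (`two_smul_fderiv_fderiv_apply`).

Two facts about `∇` support this. The transformation law `christoffel_transition` shows that a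
solution in one chart is parallel in every chart, as the definition of parallelism demands.
Smoothness of `Γ` (`contDiffOn_christoffel`) comes from applying `∇` to coordinate fields cut off by
bump functions. -/

noncomputable section

namespace TransportOp

/-! ### Chart differentials and transition maps -/

section Charts

variable {n : ℕ} {M : Type*} [TopologicalSpace M] [ChartedSpace (EuclideanSpace ℝ (Fin n)) M]
  {e e' : OpenPartialHomeomorph M (EuclideanSpace ℝ (Fin n))} {p : M}

theorem mdifferentiableAt_of_mem_maximalAtlas (he : e ∈ IsManifold.maximalAtlas (𝓡 n) ∞ M)
    (hp : p ∈ e.source) : MDifferentiableAt (𝓡 n) (𝓡 n) e p :=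
  (contMDiffAt_of_mem_maximalAtlas he hp).mdifferentiableAt (by simp)

theorem mdifferentiableAt_symm_of_mem_maximalAtlas
    (he : e ∈ IsManifold.maximalAtlas (𝓡 n) ∞ M) {x : EuclideanSpace ℝ (Fin n)}
    (hx : x ∈ e.target) : MDifferentiableAt (𝓡 n) (𝓡 n) e.symm x :=
  (contMDiffAt_symm_of_mem_maximalAtlas he hx).mdifferentiableAt (by simp)

theorem isInvertible_chartDeriv (he : e ∈ IsManifold.maximalAtlas (𝓡 n) ∞ M)
    (hp : p ∈ e.source) : (chartDeriv e p).IsInvertible := by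
  have h : e.MDifferentiable (𝓡 n) (𝓡 n) :=
    ⟨fun q hq => (mdifferentiableAt_of_mem_maximalAtlas he hq).mdifferentiableWithinAt,
      fun x hx => (mdifferentiableAt_symm_of_mem_maximalAtlas he hx).mdifferentiableWithinAt⟩
  exact ⟨h.mfderiv hp, rfl⟩

theorem chartDeriv_inverse_apply (he : e ∈ IsManifold.maximalAtlas (𝓡 n) ∞ M)
    (hp : p ∈ e.source) (w : EuclideanSpace ℝ (Fin n)) :
    chartDeriv e p ((chartDeriv e p).inverse w) = w :=
  (isInvertible_chartDeriv he hp).self_apply_inverse w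

theorem inverse_chartDeriv_apply (he : e ∈ IsManifold.maximalAtlas (𝓡 n) ∞ M)
    (hp : p ∈ e.source) (v : TangentSpace (𝓡 n) p) :
    (chartDeriv e p).inverse (chartDeriv e p v) = v :=
  (isInvertible_chartDeriv he hp).inverse_apply_self v

theorem contDiffAt_transition (he : e ∈ IsManifold.maximalAtlas (𝓡 n) ∞ M)
    (he' : e' ∈ IsManifold.maximalAtlas (𝓡 n) ∞ M) (hp : p ∈ e.source) (hp' : p ∈ e'.source) :
    ContDiffAt ℝ ∞ (e' ∘ e.symm) (e p) := by
  rw [← contMDiffAt_iff_contDiffAt]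
  refine ContMDiffAt.comp (I' := 𝓡 n) (e p) ?_
    (contMDiffAt_symm_of_mem_maximalAtlas he (e.map_source hp))
  rw [e.left_inv hp]
  exact contMDiffAt_of_mem_maximalAtlas he' hp'

theorem chartDeriv_eq_fderiv_transition_comp (he : e ∈ IsManifold.maximalAtlas (𝓡 n) ∞ M)
    (he' : e' ∈ IsManifold.maximalAtlas (𝓡 n) ∞ M) (hp : p ∈ e.source) (hp' : p ∈ e'.source) :
    chartDeriv e' p = (fderiv ℝ (e' ∘ e.symm) (e p)).comp (chartDeriv e p) := by
  have hd : DifferentiableAt ℝ (e' ∘ e.symm) (e p) :=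
    (contDiffAt_transition he he' hp hp').differentiableAt (by simp)
  have h := (hd.hasFDerivAt.hasMFDerivAt).comp p
    (mdifferentiableAt_of_mem_maximalAtlas he hp).hasMFDerivAt
  refine (h.congr_of_eventuallyEq ?_).mfderiv
  filter_upwards [e.open_source.mem_nhds hp] with q hq
  simp [e.left_inv hq]

theorem fderiv_transition (he : e ∈ IsManifold.maximalAtlas (𝓡 n) ∞ M)
    (he' : e' ∈ IsManifold.maximalAtlas (𝓡 n) ∞ M) (hp : p ∈ e.source) (hp' : p ∈ e'.source) :
    fderiv ℝ (e' ∘ e.symm) (e p) = (chartDeriv e' p).comp (chartDeriv e p).inverse := by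
  ext1 w
  rw [chartDeriv_eq_fderiv_transition_comp he he' hp hp']
  exact congrArg _ (chartDeriv_inverse_apply he hp w).symm

theorem fderiv_transition_chartDeriv (he : e ∈ IsManifold.maximalAtlas (𝓡 n) ∞ M)
    (he' : e' ∈ IsManifold.maximalAtlas (𝓡 n) ∞ M) (hp : p ∈ e.source) (hp' : p ∈ e'.source)
    (v : TangentSpace (𝓡 n) p) :
    fderiv ℝ (e' ∘ e.symm) (e p) (chartDeriv e p v) = chartDeriv e' p v := by
  rw [chartDeriv_eq_fderiv_transition_comp he he' hp hp']
  rfl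

theorem chartDeriv_eq_continuousLinearMapAt [IsManifold (𝓡 n) 1 M] {p q : M}
    (hq : q ∈ (chartAt (EuclideanSpace ℝ (Fin n)) p).source) :
    (trivializationAt (EuclideanSpace ℝ (Fin n)) (TangentSpace (𝓡 n)) p).continuousLinearMapAt ℝ q
      = chartDeriv (chartAt (EuclideanSpace ℝ (Fin n)) p) q := by
  have h := TangentBundle.continuousLinearMapAt_trivializationAt (I := 𝓡 n) hq
  exact h

end Charts

open Bundle in
theorem trivializationAt_tangent_apply {n : ℕ} {M : Type*} [TopologicalSpace M]
    [ChartedSpace (EuclideanSpace ℝ (Fin n)) M] [IsManifold (𝓡 n) 1 M] {p q : M}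
    (hq : q ∈ (chartAt (EuclideanSpace ℝ (Fin n)) p).source) (v : TangentSpace (𝓡 n) q) :
    (trivializationAt (EuclideanSpace ℝ (Fin n)) (TangentSpace (𝓡 n)) p
      (⟨q, v⟩ : TangentBundle (𝓡 n) M)).2
      = chartDeriv (chartAt (EuclideanSpace ℝ (Fin n)) p) q v := by
  rw [← chartDeriv_eq_continuousLinearMapAt hq,
    Trivialization.continuousLinearMapAt_apply_of_mem ℝ _ (by simpa using hq)]

/-! ### Smoothness of sections read in an arbitrary chart -/

section Sections

variable {n : ℕ} {M : Type*} [TopologicalSpace M] [ChartedSpace (EuclideanSpace ℝ (Fin n)) M]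
  {e e' : OpenPartialHomeomorph M (EuclideanSpace ℝ (Fin n))} {p : M}

theorem contMDiffAt_fderiv_transition (he : e ∈ IsManifold.maximalAtlas (𝓡 n) ∞ M)
    (he' : e' ∈ IsManifold.maximalAtlas (𝓡 n) ∞ M) (hp : p ∈ e.source) (hp' : p ∈ e'.source) :
    ContMDiffAt (𝓡 n) 𝓘(ℝ, EuclideanSpace ℝ (Fin n) →L[ℝ] EuclideanSpace ℝ (Fin n)) ∞
      (fun q => fderiv ℝ (e' ∘ e.symm) (e q)) p := by
  have h : ContDiffAt ℝ ∞ (fderiv ℝ (e' ∘ e.symm)) (e p) :=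
    (contDiffAt_transition he he' hp hp').fderiv_right (by simp)
  exact h.contMDiffAt.comp p (contMDiffAt_of_mem_maximalAtlas he hp)

variable [IsManifold (𝓡 n) ∞ M]

theorem contMDiffAt_section_of_chartDeriv (he : e ∈ IsManifold.maximalAtlas (𝓡 n) ∞ M)
    (hp : p ∈ e.source) {Y : ∀ q : M, TangentSpace (𝓡 n) q}
    (hY : ContMDiffAt (𝓡 n) 𝓘(ℝ, EuclideanSpace ℝ (Fin n)) ∞ (fun q => chartDeriv e q (Y q)) p) :
    ContMDiffAt (𝓡 n) ((𝓡 n).prod 𝓘(ℝ, EuclideanSpace ℝ (Fin n))) ∞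
      (fun q => (⟨q, Y q⟩ : TangentBundle (𝓡 n) M)) p := by
  rw [Bundle.contMDiffAt_section]
  have hc := IsManifold.chart_mem_maximalAtlas (I := 𝓡 n) (n := ∞) p
  refine ((contMDiffAt_fderiv_transition he hc hp (mem_chart_source _ p)).clm_apply
    hY).congr_of_eventuallyEq ?_
  filter_upwards [e.open_source.mem_nhds hp, chart_source_mem_nhds (EuclideanSpace ℝ (Fin n)) p]
    with q hq hq'
  rw [trivializationAt_tangent_apply hq',
    fderiv_transition_chartDeriv he hc hq hq']

theorem contMDiffAt_coordField (he : e ∈ IsManifold.maximalAtlas (𝓡 n) ∞ M)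
    (hp : p ∈ e.source) (w : EuclideanSpace ℝ (Fin n)) :
    ContMDiffAt (𝓡 n) ((𝓡 n).prod 𝓘(ℝ, EuclideanSpace ℝ (Fin n))) ∞
      (fun q => (⟨q, coordField e w q⟩ : TangentBundle (𝓡 n) M)) p := by
  refine contMDiffAt_section_of_chartDeriv he hp
    ((contMDiffAt_const (c := w)).congr_of_eventuallyEq ?_)
  filter_upwards [e.open_source.mem_nhds hp] with q hq
  exact chartDeriv_inverse_apply he hq w

/-- Bundle smoothness is tested in the preferred chart at `p`; passing to `e` conjugates by
derivatives of transition maps, which are smooth. -/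
theorem contMDiffAt_hom_in_chart (he : e ∈ IsManifold.maximalAtlas (𝓡 n) ∞ M)
    (hp : p ∈ e.source) {φ : ∀ q : M, TangentSpace (𝓡 n) q →L[ℝ] TangentSpace (𝓡 n) q}
    (hφ : ContMDiffAt (𝓡 n) ((𝓡 n).prod
        𝓘(ℝ, EuclideanSpace ℝ (Fin n) →L[ℝ] EuclideanSpace ℝ (Fin n))) ∞
      (fun q => (⟨q, φ q⟩ : Bundle.TotalSpace
        (EuclideanSpace ℝ (Fin n) →L[ℝ] EuclideanSpace ℝ (Fin n))
        (fun q : M => TangentSpace (𝓡 n) q →L[ℝ] TangentSpace (𝓡 n) q))) p) :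
    ContMDiffAt (𝓡 n) 𝓘(ℝ, EuclideanSpace ℝ (Fin n) →L[ℝ] EuclideanSpace ℝ (Fin n)) ∞
      (fun q => (chartDeriv e q).comp ((φ q).comp (chartDeriv e q).inverse)) p := by
  have hc := IsManifold.chart_mem_maximalAtlas (I := 𝓡 n) (n := ∞) p
  have hcp := mem_chart_source (EuclideanSpace ℝ (Fin n)) p
  rw [contMDiffAt_hom_bundle] at hφ
  refine (((contMDiffAt_fderiv_transition hc he hcp hp).clm_comp hφ.2).clm_comp
    (contMDiffAt_fderiv_transition he hc hp hcp)).congr_of_eventuallyEq ?_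
  filter_upwards [e.open_source.mem_nhds hp, chart_source_mem_nhds (EuclideanSpace ℝ (Fin n)) p]
    with q hq hq'
  ext1 w
  have hs : (Bundle.Trivialization.symmL ℝ
      (trivializationAt (EuclideanSpace ℝ (Fin n)) (TangentSpace (𝓡 n)) p) q)
        (chartDeriv (chartAt (EuclideanSpace ℝ (Fin n)) p) q ((chartDeriv e q).inverse w))
        = (chartDeriv e q).inverse w := by
    rw [← chartDeriv_eq_continuousLinearMapAt hq',
      Bundle.Trivialization.symmL_continuousLinearMapAt _ (by simpa using hq')]
  rw [fderiv_transition he hc hq hq']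
  change chartDeriv e q (φ q ((chartDeriv e q).inverse w)) =
    fderiv ℝ (e ∘ (chartAt (EuclideanSpace ℝ (Fin n)) p).symm) _
      ((Bundle.Trivialization.continuousLinearMapAt ℝ
      (trivializationAt (EuclideanSpace ℝ (Fin n)) (TangentSpace (𝓡 n)) p) q) (φ q
      ((Bundle.Trivialization.symmL ℝ
      (trivializationAt (EuclideanSpace ℝ (Fin n)) (TangentSpace (𝓡 n)) p) q)
        (chartDeriv (chartAt (EuclideanSpace ℝ (Fin n)) p) q ((chartDeriv e q).inverse w)))))
  rw [hs, chartDeriv_eq_continuousLinearMapAt hq', fderiv_transition_chartDeriv hc he hq' hq]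

end Sections

/-! ### Christoffel symbols: transformation law and smoothness -/

section Connection

variable {n : ℕ} {M : Type*} [TopologicalSpace M] [ChartedSpace (EuclideanSpace ℝ (Fin n)) M]
  [IsManifold (𝓡 n) ∞ M] {e e' : OpenPartialHomeomorph M (EuclideanSpace ℝ (Fin n))} {p : M}
  (cov : CovariantDerivative (𝓡 n) (EuclideanSpace ℝ (Fin n)) (TangentSpace (𝓡 n) : M → Type _))

theorem sum_smul_single (w : EuclideanSpace ℝ (Fin n)) :
    ∑ j, w j • EuclideanSpace.single j (1 : ℝ) = w := by
  simpa using (EuclideanSpace.basisFun (Fin n) ℝ).sum_repr w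

theorem christoffel_apply (he : e ∈ IsManifold.maximalAtlas (𝓡 n) ∞ M) (hp : p ∈ e.source)
    (v : TangentSpace (𝓡 n) p) (w : EuclideanSpace ℝ (Fin n)) :
    christoffel cov e (e p) (chartDeriv e p v) w =
      ∑ j, w j • chartDeriv e p (cov (coordField e (EuclideanSpace.single j 1)) p v) := by
  -- `christoffel` lives at `e.symm (e p)`, which is only propositionally `p`; a free `q` lets the
  -- dependent types be rewritten.
  have key : ∀ (Y : ∀ q : M, TangentSpace (𝓡 n) q) (q : M), q = p →
      chartDeriv e q (cov Y q ((chartDeriv e q).inverse (chartDeriv e p v))) =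
        chartDeriv e p (cov Y p v) := by
    rintro Y q rfl
    rw [inverse_chartDeriv_apply he hp]
  simp only [christoffel, sum_apply]
  exact Finset.sum_congr rfl fun j _ => congrArg (w j • ·) (key _ _ (e.left_inv hp))

theorem mdifferentiableAt_coordField (he : e ∈ IsManifold.maximalAtlas (𝓡 n) ∞ M)
    (hp : p ∈ e.source) (w : EuclideanSpace ℝ (Fin n)) :
    MDifferentiableAt (𝓡 n) ((𝓡 n).prod 𝓘(ℝ, EuclideanSpace ℝ (Fin n)))
      (fun q => (⟨q, coordField e w q⟩ : TangentBundle (𝓡 n) M)) p :=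
  (contMDiffAt_coordField he hp w).mdifferentiableAt (by simp)

theorem cov_sum_smul {ι : Type*} (s : Finset ι) {g : ι → M → ℝ}
    {σ : ι → ∀ q : M, TangentSpace (𝓡 n) q}
    (hg : ∀ i, MDifferentiableAt (𝓡 n) 𝓘(ℝ, ℝ) (g i) p)
    (hσ : ∀ i, MDifferentiableAt (𝓡 n) ((𝓡 n).prod 𝓘(ℝ, EuclideanSpace ℝ (Fin n)))
      (fun q => (⟨q, σ i q⟩ : TangentBundle (𝓡 n) M)) p) (v : TangentSpace (𝓡 n) p) :
    cov (∑ i ∈ s, g i • σ i) p v =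
      ∑ i ∈ s, (g i p • cov (σ i) p v + mvfderiv (𝓡 n) (g i) p v • σ i p) := by
  classical
  induction s using Finset.induction_on with
  | empty => simp
  | insert i s hi ih =>
    have hs : MDifferentiableAt (𝓡 n) ((𝓡 n).prod 𝓘(ℝ, EuclideanSpace ℝ (Fin n)))
        (fun q => (⟨q, (∑ i ∈ s, g i • σ i) q⟩ : TangentBundle (𝓡 n) M)) p := by
      have h := MDifferentiableAt.sum_section (I := 𝓡 n) (F := EuclideanSpace ℝ (Fin n)) (s := s)
        (t := fun i => g i • σ i) (x₀ := p) fun i _ => (hg i).smul_section (hσ i)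
      simpa [Finset.sum_apply] using h
    rw [Finset.sum_insert hi, Finset.sum_insert hi, ← ih,
      cov.isCovariantDerivativeOnUniv.add ((hg i).smul_section (hσ i)) hs,
      cov.isCovariantDerivativeOnUniv.leibniz (hσ i) (hg i)]
    rfl

/-- Near `p` the field is a combination of the coordinate fields of `e'` whose coefficients are the
components of `Dτ · w`, with `τ` the transition map. The Leibniz rule then produces `Γ'` from the
fields and `D²τ` from the coefficients. -/
theorem cov_coordField (he : e ∈ IsManifold.maximalAtlas (𝓡 n) ∞ M)
    (he' : e' ∈ IsManifold.maximalAtlas (𝓡 n) ∞ M) (hp : p ∈ e.source) (hp' : p ∈ e'.source)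
    (v : TangentSpace (𝓡 n) p) (w : EuclideanSpace ℝ (Fin n)) :
    chartDeriv e' p (cov (coordField e w) p v) =
      christoffel cov e' (e' p) (chartDeriv e' p v) (fderiv ℝ (e' ∘ e.symm) (e p) w) +
        fderiv ℝ (fderiv ℝ (e' ∘ e.symm)) (e p) (chartDeriv e p v) w := by
  set g : Fin n → M → ℝ := fun j q => fderiv ℝ (e' ∘ e.symm) (e q) w j
  have hgd : ∀ j, HasMFDerivAt (𝓡 n) 𝓘(ℝ, ℝ) (g j) p
      (((EuclideanSpace.proj j : EuclideanSpace ℝ (Fin n) →L[ℝ] ℝ).comp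
        ((fderiv ℝ (fderiv ℝ (e' ∘ e.symm)) (e p)).flip w)).comp (chartDeriv e p)) := by
    intro j
    have h1 : DifferentiableAt ℝ (fderiv ℝ (e' ∘ e.symm)) (e p) :=
      ((contDiffAt_transition he he' hp hp').fderiv_right (m := ∞) (by simp)).differentiableAt
        (by simp)
    have h2 : HasFDerivAt (fun y => fderiv ℝ (e' ∘ e.symm) y w j)
      ((EuclideanSpace.proj j : EuclideanSpace ℝ (Fin n) →L[ℝ] ℝ).comp
        ((fderiv ℝ (fderiv ℝ (e' ∘ e.symm)) (e p)).flip w)) (e p) := by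
      have h3 := (EuclideanSpace.proj j : EuclideanSpace ℝ (Fin n) →L[ℝ] ℝ).hasFDerivAt.comp
        (e p) (h1.hasFDerivAt.clm_apply (hasFDerivAt_const w (e p)))
      refine h3.congr_fderiv ?_
      ext u
      simp
    exact h2.hasMFDerivAt.comp p (mdifferentiableAt_of_mem_maximalAtlas he hp).hasMFDerivAt
  have hg : ∀ j, MDifferentiableAt (𝓡 n) 𝓘(ℝ, ℝ) (g j) p := fun j => (hgd j).mdifferentiableAt
  have hσ := fun j : Fin n =>
    mdifferentiableAt_coordField he' hp' (EuclideanSpace.single j (1 : ℝ))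
  have hsum : MDifferentiableAt (𝓡 n) ((𝓡 n).prod 𝓘(ℝ, EuclideanSpace ℝ (Fin n)))
      (fun q => (⟨q, (∑ j, g j • coordField e' (EuclideanSpace.single j (1 : ℝ))) q⟩ :
        TangentBundle (𝓡 n) M)) p := by
    have h := MDifferentiableAt.sum_section (I := 𝓡 n) (F := EuclideanSpace ℝ (Fin n))
      (s := Finset.univ) (t := fun j => g j • coordField e' (EuclideanSpace.single j (1 : ℝ)))
      (x₀ := p) fun j _ => (hg j).smul_section (hσ j)
    simpa [Finset.sum_apply] using h
  have hcongr : cov (coordField e w) p =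
      cov (∑ j, g j • coordField e' (EuclideanSpace.single j (1 : ℝ))) p := by
    refine cov.isCovariantDerivativeOnUniv.congr_of_eventuallyEq
      (mdifferentiableAt_coordField he hp w) hsum univ_mem ?_
    filter_upwards [e.open_source.mem_nhds hp, e'.open_source.mem_nhds hp'] with q hq hq'
    have h1 : (∑ j, g j • coordField e' (EuclideanSpace.single j (1 : ℝ))) q =
        (chartDeriv e' q).inverse (fderiv ℝ (e' ∘ e.symm) (e q) w) := by
      conv_rhs => rw [← sum_smul_single (fderiv ℝ (e' ∘ e.symm) (e q) w), map_sum]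
      simp only [Finset.sum_apply, map_smul]
      rfl
    rw [h1, fderiv_transition he he' hq hq']
    exact (inverse_chartDeriv_apply he' hq' _).symm
  rw [hcongr, cov_sum_smul cov _ hg hσ, map_sum, christoffel_apply cov he' hp']
  simp only [map_add, map_smul, Finset.sum_add_distrib]
  congr 1
  rw [← sum_smul_single (fderiv ℝ (fderiv ℝ (e' ∘ e.symm)) (e p) (chartDeriv e p v) w)]
  refine Finset.sum_congr rfl fun j _ => ?_
  have h1 : mvfderiv (𝓡 n) (g j) p v =
      fderiv ℝ (fderiv ℝ (e' ∘ e.symm)) (e p) (chartDeriv e p v) w j := by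
    rw [mvfderiv, (hgd j).mfderiv]
    rfl
  rw [h1]
  congr 1
  exact chartDeriv_inverse_apply he' hp' _

theorem christoffel_transition (he : e ∈ IsManifold.maximalAtlas (𝓡 n) ∞ M)
    (he' : e' ∈ IsManifold.maximalAtlas (𝓡 n) ∞ M) (hp : p ∈ e.source) (hp' : p ∈ e'.source)
    (v w : EuclideanSpace ℝ (Fin n)) :
    fderiv ℝ (e' ∘ e.symm) (e p) (christoffel cov e (e p) v w) =
      christoffel cov e' (e' p) (fderiv ℝ (e' ∘ e.symm) (e p) v)
          (fderiv ℝ (e' ∘ e.symm) (e p) w) +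
        fderiv ℝ (fderiv ℝ (e' ∘ e.symm)) (e p) v w := by
  obtain ⟨v, rfl⟩ : ∃ u, chartDeriv e p u = v := ⟨_, chartDeriv_inverse_apply he hp v⟩
  rw [christoffel_apply cov he hp, map_sum]
  simp only [map_smul, fderiv_transition_chartDeriv he he' hp hp',
    cov_coordField cov he he' hp hp', smul_add, Finset.sum_add_distrib]
  simp only [← map_smul, ← map_sum, sum_smul_single]

/-- Smoothness of `∇` is applied to globally smooth fields, while coordinate fields are smooth only
on the chart domain. They are multiplied by a bump function supported there, which changes nothing
near the point since `∇` is local. -/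
theorem contDiffOn_christoffel [T2Space M]
    (hcov : CovariantDerivative.ContMDiffCovariantDerivative cov ∞)
    (he : e ∈ IsManifold.maximalAtlas (𝓡 n) ∞ M) :
    ContDiffOn ℝ ∞ (christoffel cov e) e.target := by
  intro x hx
  refine ContDiffAt.contDiffWithinAt ?_
  have hp : e.symm x ∈ e.source := e.map_target hx
  obtain ⟨f, -, hf⟩ := (SmoothBumpFunction.nhds_basis_tsupport (I := 𝓡 n)
    (e.symm x)).mem_iff.1 (e.open_source.mem_nhds hp)
  have hj : ∀ j : Fin n, ContDiffAt ℝ ∞ (fun y => (chartDeriv e (e.symm y)).comp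
        ((cov (coordField e (EuclideanSpace.single j 1)) (e.symm y)).comp
          (chartDeriv e (e.symm y)).inverse)) x := by
    intro j
    have hsec := ContMDiffOn.smul_section_of_tsupport (f.contMDiff.contMDiffOn (s := e.source))
      e.open_source hf fun q hq =>
        (contMDiffAt_coordField he hq (EuclideanSpace.single j (1 : ℝ))).contMDiffWithinAt
    have hc := hcov.contMDiff.contMDiff
      (σ := (f : M → ℝ) • coordField e (EuclideanSpace.single j (1 : ℝ)))
      (by simpa using hsec.contMDiffOn)
    have h := contMDiffAt_hom_in_chart he hp ((hc (e.symm x) (mem_univ _)).contMDiffAt univ_mem)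
    have h' := (h.comp x (contMDiffAt_symm_of_mem_maximalAtlas he hx)).contDiffAt
    refine h'.congr_of_eventuallyEq ?_
    -- Locality needs equality of germs, so `f` must be `1` around each nearby point, not just at
    -- it.
    have hev : ∀ᶠ q in 𝓝 (e.symm x), ∀ᶠ r in 𝓝 q, f r = 1 :=
      eventually_eventually_nhds.2 f.eventuallyEq_one
    filter_upwards [(e.symm.continuousAt hx).eventually hev, e.open_target.mem_nhds hx]
      with y hy hyt
    have : cov (coordField e (EuclideanSpace.single j 1)) (e.symm y) =
        cov ((f : M → ℝ) • coordField e (EuclideanSpace.single j (1 : ℝ))) (e.symm y) := by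
      have hys := e.map_target hyt
      refine cov.isCovariantDerivativeOnUniv.congr_of_eventuallyEq
        (mdifferentiableAt_coordField he hys _)
        ((hsec _).mdifferentiableAt (by simp)) univ_mem ?_
      filter_upwards [hy] with r hr
      simp [hr]
    simp only [Function.comp_apply, this]
  unfold christoffel
  refine ContDiffAt.sum fun j _ => ?_
  exact (contDiffAt_const).clm_comp (hj j)

end Connection

/-! ### The geodesic and parallel transport equations as one ODE -/

section ODE

variable {F : Type*} [NormedAddCommGroup F] [NormedSpace ℝ F]

/-- Solutions of an autonomous ODE with smooth right-hand side are smooth. -/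
theorem contDiffOn_of_hasDerivAt {f : F → F} {O : Set F} (hf : ContDiffOn ℝ ∞ f O) {z : ℝ → F}
    {J : Set ℝ} (hJ : IsOpen J) (hz : ∀ t ∈ J, HasDerivAt z (f (z t)) t) (hO : MapsTo z J O) :
    ContDiffOn ℝ ∞ z J := by
  refine contDiffOn_infty.2 fun k => ?_
  -- Bootstrapping: if `z` is `C^k`, so is `z' = f ∘ z`, hence `z` is `C^(k+1)`.
  induction k with
  | zero =>
    exact contDiffOn_zero.2 fun t ht => (hz t ht).continuousAt.continuousWithinAt
  | succ k ih =>
    push_cast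
    refine (contDiffOn_succ_iff_deriv_of_isOpen hJ).2
      ⟨fun t ht => (hz t ht).differentiableAt.differentiableWithinAt, by simp, ?_⟩
    exact ((hf.of_le (by exact_mod_cast le_top)).comp ih hO).congr fun t ht => (hz t ht).deriv

/-- The vector field whose integral curves `(u, w, W)` consist of a geodesic `u`, its velocity `w`
and a parallel vector field `W` along `u`, for the Christoffel symbol `Γ`. -/
def transportField (Γ : F → F →L[ℝ] F →L[ℝ] F) (z : F × F × F) : F × F × F :=
  (z.2.1, -(Γ z.1 z.2.1 z.2.1), -(Γ z.1 z.2.1 z.2.2))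

theorem contDiffOn_transportField {Γ : F → F →L[ℝ] F →L[ℝ] F} {O : Set F}
    (hΓ : ContDiffOn ℝ ∞ Γ O) : ContDiffOn ℝ ∞ (transportField Γ) (O ×ˢ univ) := by
  have h1 : ContDiffOn ℝ ∞ (fun z : F × F × F => Γ z.1) (O ×ˢ univ) :=
    hΓ.comp contDiffOn_fst fun z hz => hz.1
  have h2 : ContDiffOn ℝ ∞ (fun z : F × F × F => z.2.1) (O ×ˢ univ) := by fun_prop
  have h3 : ContDiffOn ℝ ∞ (fun z : F × F × F => z.2.2) (O ×ˢ univ) := by fun_prop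
  exact h2.prodMk ((((h1.clm_apply h2).clm_apply h2).neg).prodMk
    (((h1.clm_apply h2).clm_apply h3).neg))

theorem exists_geodesic_parallel [CompleteSpace F] {Γ : F → F →L[ℝ] F →L[ℝ] F} {O : Set F}
    (hO : IsOpen O) (hΓ : ContDiffOn ℝ ∞ Γ O) {x : F} (hx : x ∈ O) (v ζ : F) :
    ∃ δ > 0, ∃ u w W : ℝ → F, u 0 = x ∧ w 0 = v ∧ W 0 = ζ ∧ ContDiffOn ℝ ∞ u (Ioo (-δ) δ) ∧
      ∀ t ∈ Ioo (-δ) δ, u t ∈ O ∧ HasDerivAt u (w t) t ∧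
        HasDerivAt w (-(Γ (u t) (w t) (w t))) t ∧ HasDerivAt W (-(Γ (u t) (w t) (W t))) t := by
  have hOo : IsOpen (O ×ˢ (univ : Set (F × F))) := hO.prod isOpen_univ
  have hz : (x, v, ζ) ∈ O ×ˢ (univ : Set (F × F)) := ⟨hx, mem_univ _⟩
  have hf := contDiffOn_transportField hΓ
  obtain ⟨z, hz0, ε, hε, hzd⟩ :=
    ((hf.contDiffAt (hOo.mem_nhds hz)).of_le (m := 1) (by simp)
      ).exists_forall_mem_closedBall_exists_eq_forall_mem_Ioo_hasDerivAt₀ 0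
  simp only [zero_sub, zero_add] at hzd
  have hc : ContinuousAt z 0 := (hzd 0 ⟨by linarith, hε⟩).continuousAt
  obtain ⟨δ', hδ', hδ'O⟩ := Metric.mem_nhds_iff.1
    (hc.preimage_mem_nhds (by rw [hz0]; exact hOo.mem_nhds hz))
  have hsub : ∀ t ∈ Ioo (-(min ε δ')) (min ε δ'), t ∈ Ioo (-ε) ε ∧ z t ∈ O ×ˢ univ := by
    intro t ht
    have h1 := min_le_left ε δ'
    have h2 := min_le_right ε δ'
    refine ⟨⟨by linarith [ht.1], by linarith [ht.2]⟩, hδ'O ?_⟩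
    rw [Metric.mem_ball, Real.dist_eq, sub_zero, abs_lt]
    exact ⟨by linarith [ht.1], by linarith [ht.2]⟩
  have hzs := contDiffOn_of_hasDerivAt hf isOpen_Ioo (fun t ht => hzd t (hsub t ht).1)
    fun t ht => (hsub t ht).2
  refine ⟨min ε δ', lt_min hε hδ', fun t => (z t).1, fun t => (z t).2.1, fun t => (z t).2.2,
    by simp [hz0], by simp [hz0], by simp [hz0], hzs.fst, fun t ht => ?_⟩
  have h := hzd t (hsub t ht).1
  exact ⟨(hsub t ht).2.1, h.fst, h.snd.fst, h.snd.snd⟩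

end ODE

theorem hasDerivWithinAt_clm_comp_apply {F : Type*} [NormedAddCommGroup F] [NormedSpace ℝ F]
    {A : F → F →L[ℝ] F} {A' : F →L[ℝ] F →L[ℝ] F} {u W : ℝ → F} {u' W' : F} {s : Set ℝ} {t : ℝ}
    (hA : HasFDerivAt A A' (u t)) (hu : HasDerivWithinAt u u' s t)
    (hW : HasDerivWithinAt W W' s t) :
    HasDerivWithinAt (fun τ => A (u τ) (W τ)) (A' u' (W t) + A (u t) W') s t :=
  (hA.comp_hasDerivWithinAt t hu).clm_apply hW

/-! ### From one chart to all charts -/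

section Curves

variable {n : ℕ} {M : Type*} [TopologicalSpace M] [ChartedSpace (EuclideanSpace ℝ (Fin n)) M]
  [IsManifold (𝓡 n) ∞ M] {e e' : OpenPartialHomeomorph M (EuclideanSpace ℝ (Fin n))}
  {cov : CovariantDerivative (𝓡 n) (EuclideanSpace ℝ (Fin n)) (TangentSpace (𝓡 n) : M → Type _)}

/-- A vector field that satisfies the equation of parallel transport in one chart is parallel. -/
theorem isParallelAlong_of_chart (he : e ∈ IsManifold.maximalAtlas (𝓡 n) ∞ M) {c : ℝ → M}
    {V : ∀ t : ℝ, TangentSpace (𝓡 n) (c t)} {s : Set ℝ} (hs : UniqueDiffOn ℝ s)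
    (hc : ContinuousOn c s) (hcs : MapsTo c s e.source)
    (hd : DifferentiableOn ℝ (fun τ => e (c τ)) s)
    (hV : ∀ t ∈ s, HasDerivWithinAt (fun τ : ℝ => chartDeriv e (c τ) (V τ))
      (-(christoffel cov e (e (c t)) (derivWithin (fun τ : ℝ => e (c τ)) s t)
        (chartDeriv e (c t) (V t)))) s t) :
    IsParallelAlong cov c V s := by
  intro e' he' t ht hct'
  have hct := hcs ht
  set D := derivWithin (fun τ : ℝ => e (c τ)) s t
  have hu : HasDerivWithinAt (fun τ => e (c τ)) D s t := (hd t ht).hasDerivWithinAt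
  have hev : ∀ᶠ τ in 𝓝[s] t, c τ ∈ e.source ∩ e'.source := by
    filter_upwards [self_mem_nhdsWithin,
      (hc t ht).preimage_mem_nhdsWithin (e'.open_source.mem_nhds hct')] with τ h1 h2
    exact ⟨hcs h1, h2⟩
  have hτ := contDiffAt_transition he he' hct hct'
  have hτ1 : HasFDerivAt (e' ∘ e.symm) (fderiv ℝ (e' ∘ e.symm) (e (c t))) (e (c t)) :=
    (hτ.differentiableAt (by simp)).hasFDerivAt
  have hτ2 : HasFDerivAt (fderiv ℝ (e' ∘ e.symm)) (fderiv ℝ (fderiv ℝ (e' ∘ e.symm)) (e (c t)))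
      (e (c t)) :=
    ((hτ.fderiv_right (m := ∞) (by simp)).differentiableAt (by simp)).hasFDerivAt
  have hu' : HasDerivWithinAt (fun τ => e' (c τ)) (fderiv ℝ (e' ∘ e.symm) (e (c t)) D) s t := by
    refine (hτ1.comp_hasDerivWithinAt t hu).congr_of_eventuallyEq_of_mem ?_ ht
    filter_upwards [hev] with τ h
    simp [e.left_inv h.1]
  have hW : HasDerivWithinAt (fun τ => chartDeriv e' (c τ) (V τ))
      (fderiv ℝ (fderiv ℝ (e' ∘ e.symm)) (e (c t)) D (chartDeriv e (c t) (V t)) +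
        fderiv ℝ (e' ∘ e.symm) (e (c t)) (-(christoffel cov e (e (c t)) D
          (chartDeriv e (c t) (V t))))) s t := by
    have h := hasDerivWithinAt_clm_comp_apply hτ2 hu (hV t ht)
    refine h.congr_of_eventuallyEq_of_mem ?_ ht
    filter_upwards [hev] with τ h
    exact (fderiv_transition_chartDeriv he he' h.1 h.2 _).symm
  rw [hu'.derivWithin (hs t ht)]
  refine hW.congr_deriv ?_
  -- The second-derivative term from differentiating `Dτ` along the curve cancels the inhomogeneous
  -- term of the transformation law.
  rw [map_neg, christoffel_transition cov he he' hct hct',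
    fderiv_transition_chartDeriv he he' hct hct']
  abel

/-- A smooth curve that satisfies the geodesic equation in one chart is a geodesic. -/
theorem isGeodesicOn_of_chart (he : e ∈ IsManifold.maximalAtlas (𝓡 n) ∞ M)
    {u w : ℝ → EuclideanSpace ℝ (Fin n)} {s : Set ℝ} (hs : UniqueDiffOn ℝ s)
    (hu : ContDiffOn ℝ ∞ u s) (hut : MapsTo u s e.target)
    (hw : ∀ t ∈ s, HasDerivWithinAt u (w t) s t)
    (hg : ∀ t ∈ s, HasDerivWithinAt w (-(christoffel cov e (u t) (w t) (w t))) s t) :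
    IsGeodesicOn cov (fun t => e.symm (u t)) s := by
  have hsm : ContMDiffOn 𝓘(ℝ, ℝ) (𝓡 n) ∞ (fun t => e.symm (u t)) s :=
    (contMDiffOn_symm_of_mem_maximalAtlas he).comp hu.contMDiffOn hut
  have heq : EqOn (fun τ => e (e.symm (u τ))) u s := fun t ht => e.right_inv (hut ht)
  have hvel : ∀ t ∈ s, chartDeriv e (e.symm (u t)) (velocity (fun t => e.symm (u t)) s t) =
      w t := by
    intro t ht
    have h1 := (mdifferentiableAt_of_mem_maximalAtlas he (e.map_target (hut ht))).hasMFDerivAt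
    have h2 := ((hsm t ht).mdifferentiableWithinAt (by simp)).hasMFDerivWithinAt
    have h3 : HasFDerivWithinAt (fun τ => e (e.symm (u τ)))
      ((chartDeriv e (e.symm (u t))).comp (mfderivWithin 𝓘(ℝ, ℝ) (𝓡 n)
        (fun t => e.symm (u t)) s t) : ℝ →L[ℝ] EuclideanSpace ℝ (Fin n)) s t :=
      (h1.comp_hasMFDerivWithinAt t h2).hasFDerivWithinAt
    have h4 : HasDerivWithinAt (fun τ => e (e.symm (u τ)))
      (chartDeriv e (e.symm (u t)) (velocity (fun t => e.symm (u t)) s t)) s t :=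
      h3.hasDerivWithinAt
    rw [← h4.derivWithin (hs t ht), ((hw t ht).congr_of_mem heq ht).derivWithin (hs t ht)]
  refine ⟨hsm, isParallelAlong_of_chart he hs hsm.continuousOn
    (fun t ht => e.map_target (hut ht)) ((hu.differentiableOn (by simp)).congr heq) ?_⟩
  intro t ht
  have hr : e (e.symm (u t)) = u t := heq ht
  rw [hvel t ht, hr, (((hw t ht).congr_of_mem heq ht).derivWithin (hs t ht))]
  exact (hg t ht).congr_of_mem hvel ht

end Curves

/-! ### The transport operator along short geodesics -/

section Transport

variable {n : ℕ} {M : Type*} [TopologicalSpace M] [ChartedSpace (EuclideanSpace ℝ (Fin n)) M]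
  [IsManifold (𝓡 n) ∞ M] {e : OpenPartialHomeomorph M (EuclideanSpace ℝ (Fin n))}
  {cov : CovariantDerivative (𝓡 n) (EuclideanSpace ℝ (Fin n)) (TangentSpace (𝓡 n) : M → Type _)}

theorem localRep_apply_of_parallel {U : Set M}
    {A : ∀ p q : M, TangentSpace (𝓡 n) p →L[ℝ] TangentSpace (𝓡 n) q}
    (hA : ∀ c : ℝ → M, IsGeodesicOn cov c (Icc 0 1) → MapsTo c (Icc 0 1) U →
      ∀ V : (∀ t : ℝ, TangentSpace (𝓡 n) (c t)), IsParallelAlong cov c V (Icc 0 1) →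
        A (c 0) (c 1) (V 0) = V 1)
    (he : e ∈ IsManifold.maximalAtlas (𝓡 n) ∞ M) {u w W : ℝ → EuclideanSpace ℝ (Fin n)}
    (hu : ContDiffOn ℝ ∞ u (Icc 0 1)) (hut : MapsTo u (Icc 0 1) (e.target ∩ e.symm ⁻¹' U))
    (hw : ∀ t ∈ Icc (0 : ℝ) 1, HasDerivWithinAt u (w t) (Icc 0 1) t)
    (hg : ∀ t ∈ Icc (0 : ℝ) 1,
      HasDerivWithinAt w (-(christoffel cov e (u t) (w t) (w t))) (Icc 0 1) t)
    (hW : ∀ t ∈ Icc (0 : ℝ) 1,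
      HasDerivWithinAt W (-(christoffel cov e (u t) (w t) (W t))) (Icc 0 1) t) :
    localRep A e e (u 0, u 1) (W 0) = W 1 := by
  have hs : UniqueDiffOn ℝ (Icc (0 : ℝ) 1) := uniqueDiffOn_Icc one_pos
  have hgeo := isGeodesicOn_of_chart (cov := cov) he hs hu (fun t ht => (hut ht).1) hw hg
  have heq : EqOn (fun τ => e (e.symm (u τ))) u (Icc 0 1) := fun t ht => e.right_inv (hut ht).1
  have hsrc : MapsTo (fun t => e.symm (u t)) (Icc 0 1) e.source :=
    fun t ht => e.map_target (hut ht).1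
  have hVW : ∀ t ∈ Icc (0 : ℝ) 1, chartDeriv e (e.symm (u t))
      ((chartDeriv e (e.symm (u t))).inverse (W t)) = W t :=
    fun t ht => chartDeriv_inverse_apply he (hsrc ht) _
  have hpar := hA _ hgeo (fun t ht => (hut ht).2)
    (fun t => (chartDeriv e (e.symm (u t))).inverse (W t))
    (isParallelAlong_of_chart he hs hgeo.1.continuousOn hsrc
      ((hu.differentiableOn (by simp)).congr heq) fun t ht => by
        have hr : e (e.symm (u t)) = u t := heq ht
        rw [hVW t ht, hr, (((hw t ht).congr_of_mem heq ht).derivWithin (hs t ht))]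
        exact (hW t ht).congr_of_mem hVW ht)
  have h := congrArg (chartDeriv e (e.symm (u 1))) hpar
  rw [hVW 1 (by simp)] at h
  exact h

/-- Association speaks of geodesics on `[0, 1]`, so the solution is rescaled to `t ↦ u (s * t)`.
Both signs of `s` occur, which makes the identity hold on a full neighbourhood of `0` and lets it be
differentiated there. -/
theorem exists_geodesic_localRep {A : TransportOperator n M} (hA : A.IsAssociated cov)
    (he : e ∈ IsManifold.maximalAtlas (𝓡 n) ∞ M)
    (hΓ : ContDiffOn ℝ ∞ (christoffel cov e) e.target) {x : EuclideanSpace ℝ (Fin n)}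
    (hx : x ∈ e.target) (v ζ : EuclideanSpace ℝ (Fin n)) :
    ∃ u w W : ℝ → EuclideanSpace ℝ (Fin n), u 0 = x ∧ w 0 = v ∧ W 0 = ζ ∧
      ∀ᶠ t in 𝓝 0, u t ∈ e.target ∧ HasDerivAt u (w t) t ∧
        HasDerivAt w (-(christoffel cov e (u t) (w t) (w t))) t ∧
        HasDerivAt W (-(christoffel cov e (u t) (w t) (W t))) t ∧
        localRep A.toFun e e (x, u t) ζ = W t := by
  obtain ⟨U, hU, hxU, -, hAU⟩ := hA (e.symm x)
  obtain ⟨δ, hδ, u, w, W, hu0, hw0, hW0, hu, h⟩ := exists_geodesic_parallel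
    (e.symm.isOpen_inter_preimage hU) (hΓ.mono inter_subset_left) ⟨hx, hxU⟩ v ζ
  refine ⟨u, w, W, hu0, hw0, hW0, ?_⟩
  filter_upwards [Ioo_mem_nhds (neg_lt_zero.2 hδ) hδ] with s hs
  obtain ⟨h1, h2, h3, h4⟩ := h s hs
  refine ⟨h1.1, h2, h3, h4, ?_⟩
  have hmaps : MapsTo (fun t : ℝ => s * t) (Icc 0 1) (Ioo (-δ) δ) := by
    intro t ht
    have : |s * t| < δ := by
      rw [abs_mul, abs_of_nonneg ht.1]
      exact (mul_le_of_le_one_right (abs_nonneg s) ht.2).trans_lt (abs_lt.2 hs)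
    exact abs_lt.1 this
  have hmul : ∀ t : ℝ, HasDerivAt (fun t : ℝ => s * t) s t := fun t => by
    simpa using (hasDerivAt_id t).const_mul s
  have key := localRep_apply_of_parallel hAU he (u := fun t => u (s * t))
    (w := fun t => s • w (s * t)) (W := fun t => W (s * t))
    (hu.comp (by fun_prop) hmaps) (fun t ht => (h _ (hmaps ht)).1)
    (fun t ht => ((h _ (hmaps ht)).2.1.scomp t (hmul t)).hasDerivWithinAt)
    -- The rescaled velocity is `s • w`; its derivative carries `s²`, matching the quadratic
    -- right-hand side.
    (fun t ht => by
      have h5 := (((h _ (hmaps ht)).2.2.1.scomp t (hmul t)).const_smul s).hasDerivWithinAt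
        (s := Icc (0 : ℝ) 1)
      refine h5.congr_deriv ?_
      simp)
    (fun t ht => by
      have h5 := ((h _ (hmaps ht)).2.2.2.scomp t (hmul t)).hasDerivWithinAt
        (s := Icc (0 : ℝ) 1)
      refine h5.congr_deriv ?_
      simp)
  simpa [hu0, hW0] using key

end Transport

/-! ### Derivatives of `a` on the diagonal -/

section Taylor

variable {F : Type*} [NormedAddCommGroup F] [NormedSpace ℝ F] {T : Set F}
  {a : F × F → F →L[ℝ] F} {Γ : F → F →L[ℝ] F →L[ℝ] F} {x : F}

theorem hasDerivAt_clm_apply_comp {P G : Type*} [NormedAddCommGroup P] [NormedSpace ℝ P]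
    [NormedAddCommGroup G] [NormedSpace ℝ G] {B : P → F →L[ℝ] G} {B' : P →L[ℝ] F →L[ℝ] G}
    {u : ℝ → P} {u' : P} {W : ℝ → F} {W' : F} {t : ℝ} (hB : HasFDerivAt B B' (u t))
    (hu : HasDerivAt u u' t) (hW : HasDerivAt W W' t) :
    HasDerivAt (fun τ => B (u τ) (W τ)) (B' u' (W t) + B (u t) W') t :=
  (hB.comp_hasDerivAt t hu).clm_apply hW

theorem hasDerivAt_clm_apply_apply_comp {P Q G : Type*} [NormedAddCommGroup P] [NormedSpace ℝ P]
    [NormedAddCommGroup Q] [NormedSpace ℝ Q] [NormedAddCommGroup G] [NormedSpace ℝ G]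
    {B : P → Q →L[ℝ] F →L[ℝ] G} {B' : P →L[ℝ] Q →L[ℝ] F →L[ℝ] G}
    {u : ℝ → P} {u' : P} {w : ℝ → Q} {w' : Q} {W : ℝ → F} {W' : F} {t : ℝ}
    (hB : HasFDerivAt B B' (u t)) (hu : HasDerivAt u u' t) (hw : HasDerivAt w w' t)
    (hW : HasDerivAt W W' t) :
    HasDerivAt (fun τ => B (u τ) (w τ) (W τ))
      (B' u' (w t) (W t) + B (u t) w' (W t) + B (u t) (w t) W') t :=
  (hasDerivAt_clm_apply_comp hB hu hw).clm_apply hW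

theorem hasDerivAt_add_smul (x v : F) (t : ℝ) : HasDerivAt (fun τ : ℝ => x + τ • v) v t := by
  simpa using ((hasDerivAt_id t).smul_const v).const_add x

theorem eventually_add_smul_mem (hT : IsOpen T) (hx : x ∈ T) (v : F) :
    ∀ᶠ τ in 𝓝 (0 : ℝ), x + τ • v ∈ T :=
  (hasDerivAt_add_smul x v 0).continuousAt.eventually (hT.mem_nhds (by simpa using hx))

/-- Since `a` is constant on the diagonal, its derivative kills `(ξ, ξ)`, and `(ξ, η) = (ξ, ξ) + (0,
η - ξ)`. -/
theorem fderiv_apply_of_diag (hT : IsOpen T) (hx : x ∈ T) (ha : DifferentiableAt ℝ a (x, x))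
    (hdiag : ∀ y ∈ T, a (y, y) = ContinuousLinearMap.id ℝ F)
    (h0 : ∀ v ζ, fderiv ℝ a (x, x) (0, v) ζ = -(Γ x v ζ)) (ξ η ζ : F) :
    fderiv ℝ a (x, x) (ξ, η) ζ = -(Γ x (η - ξ) ζ) := by
  have hl := hasDerivAt_add_smul x ξ 0
  have ha' : HasFDerivAt a (fderiv ℝ a (x, x)) (x + (0 : ℝ) • ξ, x + (0 : ℝ) • ξ) := by
    simpa using ha.hasFDerivAt
  have h1 := hasDerivAt_clm_apply_comp (u := fun τ : ℝ => (x + τ • ξ, x + τ • ξ)) ha'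
    (hl.prodMk hl) (hasDerivAt_const (0 : ℝ) ζ)
  have h2 : HasDerivAt (fun τ : ℝ => a (x + τ • ξ, x + τ • ξ) ζ) 0 0 := by
    refine (hasDerivAt_const (0 : ℝ) ζ).congr_of_eventuallyEq ?_
    filter_upwards [eventually_add_smul_mem hT hx ξ] with τ hτ
    rw [hdiag _ hτ, ContinuousLinearMap.id_apply]
  have h3 : fderiv ℝ a (x, x) (ξ, ξ) ζ = 0 := by simpa using h1.unique h2
  have h4 : ((ξ, η) : F × F) = (ξ, ξ) + (0, η - ξ) := by simp
  rw [h4, map_add, add_apply, h3, zero_add, h0]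

theorem fderiv_fderiv_apply_diag (hT : IsOpen T) (hx : x ∈ T)
    (ha : DifferentiableAt ℝ (fderiv ℝ a) (x, x)) (hΓ : DifferentiableAt ℝ Γ x)
    (h1 : ∀ y ∈ T, ∀ ξ η ζ, fderiv ℝ a (y, y) (ξ, η) ζ = -(Γ y (η - ξ) ζ)) (v ξ η ζ : F) :
    fderiv ℝ (fderiv ℝ a) (x, x) (v, v) (ξ, η) ζ = -(fderiv ℝ Γ x v (η - ξ) ζ) := by
  have hl := hasDerivAt_add_smul x v 0
  have ha' : HasFDerivAt (fderiv ℝ a) (fderiv ℝ (fderiv ℝ a) (x, x))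
      (x + (0 : ℝ) • v, x + (0 : ℝ) • v) := by
    simpa using ha.hasFDerivAt
  have hΓ' : HasFDerivAt Γ (fderiv ℝ Γ x) (x + (0 : ℝ) • v) := by simpa using hΓ.hasFDerivAt
  have h2 := hasDerivAt_clm_apply_apply_comp (u := fun τ : ℝ => (x + τ • v, x + τ • v)) ha'
    (hl.prodMk hl) (hasDerivAt_const (0 : ℝ) (ξ, η)) (hasDerivAt_const (0 : ℝ) ζ)
  have h3 := (hasDerivAt_clm_apply_apply_comp hΓ' hl (hasDerivAt_const (0 : ℝ) (η - ξ))
    (hasDerivAt_const (0 : ℝ) ζ)).neg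
  have h4 := h2.unique (h3.congr_of_eventuallyEq (by
    filter_upwards [eventually_add_smul_mem hT hx v] with τ hτ using h1 _ hτ ξ η ζ))
  simpa using h4

/-- If `s ↦ a (x, u s) ζ` is parallel along `u`, then the derivative of `a` in the direction of
the velocity of `u` is determined by `Γ`. -/
theorem fderiv_apply_of_parallel {ζ : F} {u w W : ℝ → F}
    (ha : ContDiffAt ℝ ∞ a (x, x)) (hu0 : u 0 = x)
    (hu : ∀ᶠ t in 𝓝 0, HasDerivAt u (w t) t)
    (hW : ∀ᶠ t in 𝓝 0, HasDerivAt W (-(Γ (u t) (w t) (W t))) t)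
    (h : ∀ᶠ t in 𝓝 0, a (x, u t) ζ = W t) :
    ∀ᶠ t in 𝓝 0, fderiv ℝ a (x, u t) (0, w t) ζ = -(Γ (u t) (w t) (W t)) := by
  have hc : ContinuousAt (fun t => (x, u t)) 0 :=
    continuousAt_const.prodMk hu.self_of_nhds.continuousAt
  have had : ∀ᶠ z in 𝓝 (x, u 0), DifferentiableAt ℝ a z := by
    rw [hu0]
    exact ((ha.of_le (m := 1) (by simp)).eventually (by simp)).mono
      fun z hz => hz.differentiableAt (by simp)
  filter_upwards [hc.eventually had, hu, hW, eventually_eventually_nhds.2 h] with t h1 h2 h3 h4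
  have h5 := hasDerivAt_clm_apply_comp (u := fun τ => (x, u τ)) h1.hasFDerivAt
    ((hasDerivAt_const t x).prodMk h2) (hasDerivAt_const t ζ)
  have h6 := h5.unique (h3.congr_of_eventuallyEq h4)
  simpa using h6

theorem fderiv_fderiv_apply_of_parallel {v ζ w' : F} {u w W : ℝ → F}
    (ha : DifferentiableAt ℝ (fderiv ℝ a) (x, x)) (hΓ : DifferentiableAt ℝ Γ x)
    (hu0 : u 0 = x) (hw0 : w 0 = v) (hW0 : W 0 = ζ)
    (hu : HasDerivAt u v 0) (hw : HasDerivAt w w' 0) (hW : HasDerivAt W (-(Γ x v ζ)) 0)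
    (h : ∀ᶠ t in 𝓝 0, fderiv ℝ a (x, u t) (0, w t) ζ = -(Γ (u t) (w t) (W t)))
    (h0 : ∀ v ζ, fderiv ℝ a (x, x) (0, v) ζ = -(Γ x v ζ)) :
    fderiv ℝ (fderiv ℝ a) (x, x) (0, v) (0, v) ζ =
      -(fderiv ℝ Γ x v v ζ) + Γ x v (Γ x v ζ) := by
  have ha1 : HasFDerivAt (fderiv ℝ a) (fderiv ℝ (fderiv ℝ a) (x, x)) (x, u 0) := by
    rw [hu0]
    exact ha.hasFDerivAt
  have hΓ1 : HasFDerivAt Γ (fderiv ℝ Γ x) (u 0) := by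
    rw [hu0]
    exact hΓ.hasFDerivAt
  have h1 := hasDerivAt_clm_apply_apply_comp (u := fun τ => (x, u τ)) (w := fun τ => (0, w τ)) ha1
    ((hasDerivAt_const (0 : ℝ) x).prodMk hu) ((hasDerivAt_const (0 : ℝ) (0 : F)).prodMk hw)
    (hasDerivAt_const (0 : ℝ) ζ)
  have h2 := (hasDerivAt_clm_apply_apply_comp hΓ1 hu hw hW).neg
  have h3 := h1.unique (h2.congr_of_eventuallyEq h)
  -- By `h0`, the acceleration `w'` contributes `-(Γ x w' ζ)` to both sides and drops out.
  simp only [hu0, hw0, hW0, map_zero, add_zero, neg_zero, h0, map_neg] at h3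
  rw [← eq_sub_iff_add_eq] at h3
  rw [h3]
  abel

/-- Each argument splits as `(ξ, ξ) + (0, d)` with `d = η - ξ`. Pairings with a diagonal vector are
given by `hd` and symmetry, the remaining one by polarizing `h0`. The factor `2` comes from
polarization, and `2ξ + d = η + ξ` explains the sums inside `Γ'`. -/
theorem two_smul_fderiv_fderiv_apply
    (ha : ContDiffAt ℝ ∞ a (x, x))
    (hd : ∀ v ξ η ζ, fderiv ℝ (fderiv ℝ a) (x, x) (v, v) (ξ, η) ζ = -(fderiv ℝ Γ x v (η - ξ) ζ))
    (h0 : ∀ v ζ, fderiv ℝ (fderiv ℝ a) (x, x) (0, v) (0, v) ζ =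
      -(fderiv ℝ Γ x v v ζ) + Γ x v (Γ x v ζ)) (ξ₁ η₁ ξ₂ η₂ ζ : F) :
    (2 : ℝ) • fderiv ℝ (fderiv ℝ a) (x, x) (ξ₁, η₁) (ξ₂, η₂) ζ =
      -(fderiv ℝ Γ x (η₁ + ξ₁) (η₂ - ξ₂) ζ) - fderiv ℝ Γ x (η₂ + ξ₂) (η₁ - ξ₁) ζ
        + Γ x (η₁ - ξ₁) (Γ x (η₂ - ξ₂) ζ) + Γ x (η₂ - ξ₂) (Γ x (η₁ - ξ₁) ζ) := by
  have hsymm : IsSymmSndFDerivAt ℝ a (x, x) := ha.isSymmSndFDerivAt (by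
    rw [minSmoothness_of_isRCLikeNormedField]; exact ENat.LEInfty.out)
  set B := fderiv ℝ (fderiv ℝ a) (x, x)
  obtain ⟨d₁, rfl⟩ : ∃ d, η₁ = ξ₁ + d := ⟨η₁ - ξ₁, by abel⟩
  obtain ⟨d₂, rfl⟩ : ∃ d, η₂ = ξ₂ + d := ⟨η₂ - ξ₂, by abel⟩
  have hs : ∀ p q, B p q = B q p := fun p q => hsymm.eq p q
  have hsplit : ∀ ξ d : F, ((ξ, ξ + d) : F × F) = (ξ, ξ) + (0, d) := fun ξ d => by simp
  have hadd : ((0, d₁ + d₂) : F × F) = (0, d₁) + (0, d₂) := by simp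
  have hpol := h0 (d₁ + d₂) ζ
  have hp1 := h0 d₁ ζ
  have hp2 := h0 d₂ ζ
  have hm1 := hd ξ₁ ξ₂ (ξ₂ + d₂) ζ
  have hm2 := hd ξ₂ 0 d₁ ζ
  rw [hadd] at hpol
  rw [hsplit] at hm1
  simp only [map_add, add_apply, add_sub_cancel_left, sub_zero] at hpol hm1 hm2
  rw [hsplit, hsplit]
  simp only [map_add, add_apply, add_sub_cancel_left] at *
  rw [hp1, hp2, hs (0, d₂) (0, d₁)] at hpol
  rw [hs (0, d₁) (ξ₂, ξ₂), hm2, two_smul]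
  linear_combination (norm := module) (2 : ℝ) • hm1 + hpol

end Taylor

end TransportOp

end

/-! ### The main theorem -/

theorem mainTheorem8 {n : ℕ} {M : Type*} [TopologicalSpace M] [T2Space M]
    [SecondCountableTopology M] [ChartedSpace (EuclideanSpace ℝ (Fin n)) M]
    [IsManifold (𝓡 n) ∞ M]
    (cov : CovariantDerivative (𝓡 n) (EuclideanSpace ℝ (Fin n))
      (TangentSpace (𝓡 n) : M → Type _))
    (hcov : CovariantDerivative.ContMDiffCovariantDerivative cov ∞)
    (A : TransportOp.TransportOperator n M) (hA : A.IsAssociated cov)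
    (e : OpenPartialHomeomorph M (EuclideanSpace ℝ (Fin n)))
    (he : e ∈ IsManifold.maximalAtlas (𝓡 n) ∞ M)
    (a : EuclideanSpace ℝ (Fin n) × EuclideanSpace ℝ (Fin n) →
      EuclideanSpace ℝ (Fin n) →L[ℝ] EuclideanSpace ℝ (Fin n))
    (ha : a = TransportOp.localRep A.toFun e e)
    (Γ : EuclideanSpace ℝ (Fin n) →
      EuclideanSpace ℝ (Fin n) →L[ℝ] EuclideanSpace ℝ (Fin n) →L[ℝ] EuclideanSpace ℝ (Fin n))
    (hΓ : Γ = TransportOp.christoffel cov e) :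
    ContDiffOn ℝ ∞ Γ e.target ∧ ContDiffOn ℝ ∞ a (e.target ×ˢ e.target) ∧
    ∀ x ∈ e.target,
      a (x, x) = ContinuousLinearMap.id ℝ (EuclideanSpace ℝ (Fin n)) ∧
      (∀ ξ η ζ : EuclideanSpace ℝ (Fin n),
        fderiv ℝ a (x, x) (ξ, η) ζ = -(Γ x (η - ξ) ζ)) ∧
      (∀ ξ₁ η₁ ξ₂ η₂ ζ : EuclideanSpace ℝ (Fin n),
        (2 : ℝ) • fderiv ℝ (fderiv ℝ a) (x, x) (ξ₁, η₁) (ξ₂, η₂) ζ =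
          -(fderiv ℝ Γ x (η₁ + ξ₁) (η₂ - ξ₂) ζ)
          - fderiv ℝ Γ x (η₂ + ξ₂) (η₁ - ξ₁) ζ
          + Γ x (η₁ - ξ₁) (Γ x (η₂ - ξ₂) ζ)
          + Γ x (η₂ - ξ₂) (Γ x (η₁ - ξ₁) ζ)) := by
  subst ha hΓ
  set a := TransportOp.localRep A.toFun e e
  set Γ := TransportOp.christoffel cov e
  have hΓs : ContDiffOn ℝ ∞ Γ e.target := TransportOp.contDiffOn_christoffel cov hcov he
  have has : ContDiffOn ℝ ∞ a (e.target ×ˢ e.target) := A.smooth e he e he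
  have haAt : ∀ x ∈ e.target, ContDiffAt ℝ ∞ a (x, x) := fun x hx =>
    has.contDiffAt ((e.open_target.prod e.open_target).mem_nhds ⟨hx, hx⟩)
  have haAt' : ∀ x ∈ e.target, DifferentiableAt ℝ (fderiv ℝ a) (x, x) := fun x hx =>
    ((haAt x hx).fderiv_right (m := ∞) (by simp)).differentiableAt (by simp)
  have hΓAt : ∀ x ∈ e.target, DifferentiableAt ℝ Γ x := fun x hx =>
    (hΓs.contDiffAt (e.open_target.mem_nhds hx)).differentiableAt (by simp)
  have hex := fun x (hx : x ∈ e.target) => TransportOp.exists_geodesic_localRep hA he hΓs hx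
  have hdiag : ∀ x ∈ e.target, a (x, x) = ContinuousLinearMap.id ℝ _ := by
    intro x hx
    ext1 ζ
    -- Only time `0` matters here, so any initial velocity would serve.
    obtain ⟨u, w, W, hu0, -, hW0, h⟩ := hex x hx 0 ζ
    have h' := h.self_of_nhds.2.2.2.2
    rw [hu0, hW0] at h'
    exact h'
  have hfirst : ∀ x ∈ e.target, ∀ v ζ, fderiv ℝ a (x, x) (0, v) ζ = -(Γ x v ζ) := by
    intro x hx v ζ
    obtain ⟨u, w, W, hu0, hw0, hW0, h⟩ := hex x hx v ζ
    have h' := (TransportOp.fderiv_apply_of_parallel (haAt x hx) hu0 (h.mono fun _ h => h.2.1)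
      (h.mono fun _ h => h.2.2.2.1) (h.mono fun _ h => h.2.2.2.2)).self_of_nhds
    rwa [hu0, hw0, hW0] at h'
  have hfirst' : ∀ x ∈ e.target, ∀ ξ η ζ, fderiv ℝ a (x, x) (ξ, η) ζ = -(Γ x (η - ξ) ζ) :=
    fun x hx => TransportOp.fderiv_apply_of_diag e.open_target hx
      ((haAt x hx).differentiableAt (by simp)) hdiag (hfirst x hx)
  refine ⟨hΓs, has, fun x hx => ⟨hdiag x hx, hfirst' x hx, ?_⟩⟩
  refine TransportOp.two_smul_fderiv_fderiv_apply (haAt x hx)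
    (TransportOp.fderiv_fderiv_apply_diag e.open_target hx (haAt' x hx) (hΓAt x hx) hfirst') ?_
  intro v ζ
  obtain ⟨u, w, W, hu0, hw0, hW0, h⟩ := hex x hx v ζ
  obtain ⟨-, hu, hw, hW, -⟩ := h.self_of_nhds
  rw [hw0] at hu
  rw [hu0, hw0, hW0] at hW
  exact TransportOp.fderiv_fderiv_apply_of_parallel (haAt' x hx) (hΓAt x hx) hu0 hw0 hW0 hu hw hW
    (TransportOp.fderiv_apply_of_parallel (haAt x hx) hu0 (h.mono fun _ h => h.2.1)
      (h.mono fun _ h => h.2.2.2.1) (h.mono fun _ h => h.2.2.2.2)) (hfirst x hx)
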